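/- A coordination game with equal-split distribution rule and without individual preferences on a graph $G=(V,E)$ with $c$ colors is given by nonempty color sets $S_i\subseteq\{1,\dots,c\}$ for the players $i\in V$ and edge weights $w_e\ge 0$ for $e\in E$. In a profile $s$ with $s_i\in S_i$ for all $i$, player $i$ has utility $u_i(s)=\frac12\sum_{\{i,j\}\in E:\,s_i=s_j}w_{ij}$, and the social welfare is $u(s)=\sum_{i\in V}u_i(s)$. For $\epsilon\ge1$ and $k\ge 1$, the profile $s$ is an $(\epsilon,k)$-equilibrium if for every nonempty $K\subseteq V$ with $|K|\le k$ and all $s'_i\in S_i$ $(i\in K)$ some $j\in K$ satisfies $u_j(s_{-K},s'_K)\le\epsilon\, u_j(s)$. Let $\mathcal G_G(c)$ be the set of all such games on $G$ with $c$ colors, and let $(\epsilon,k)\text{-PoA}(\mathcal G_G(c))\in[0,\infty]$ be the supremum of $u(s^*)/u(s)$ over all games in $\mathcal G_G(c)$ and all their $(\epsilon,k)$-equilibria $s$, where $s^*$ is a profile of maximum social welfare (with $a/0=\infty$ for $a>0$ and $0/0=1$). Theorem. Let $k\ge2$ be an integer and $d>0$ a real number. There are constants $C_1,C_2>0$, depending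 only on $k$ and $d$, such that for every real $\epsilon\ge1$ and every sequence of integers $(c_n)_{n\in\mathbb N}$ with $c_n\ge3$ for all $n$, the Erdős–Rényi random graph $G_n\sim G(n,d/n)$ on $n$ nodes satisfies $$\lim_{n\to\infty}\mathbb P\left\{C_1\,\frac{\epsilon\ln n}{\ln\ln n}\;\le\;(\epsilon,k)\text{-PoA}(\mathcal G_{G_n}(c_n))\;\le\; C_2\,\frac{\epsilon\ln n}{\ln\ln n}\right\}=1 .$$ In other words, $(\epsilon,k)\text{-PoA}(\mathcal G_{G_n}(c_n))=\Theta\left(\frac{\epsilon\ln n}{\ln\ln n}\right)$ with high probability. -/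

import Mathlib

open Filter Topology

/-- A clustering game on the graph `G` with color set `Fin c`. The functions `w`, `α`, `q` are only
relevant on edges, on incident pairs, and on the available colors, respectively. -/
structure ClusteringGame {V : Type*} (G : SimpleGraph V) (c : ℕ) where
  /-- coordination edges -/
  Ec : Set (Sym2 V)
  /-- anti-coordination edges -/
  Ea : Set (Sym2 V)
  union_eq : Ec ∪ Ea = G.edgeSet
  disjoint : Disjoint Ec Ea
  /-- the colors available to each player -/
  S : V → Set (Fin c)
  S_nonempty : ∀ i, (S i).Nonempty
  /-- split parameters -/
  α : V → V → ℝ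
  α_nonneg : ∀ i j, G.Adj i j → 0 ≤ α i j
  α_pos : ∀ i j, G.Adj i j → 0 < α i j + α j i
  /-- edge weights -/
  w : Sym2 V → ℝ
  w_nonneg : ∀ e ∈ G.edgeSet, 0 ≤ w e
  /-- individual preferences -/
  q : V → Fin c → ℝ
  q_nonneg : ∀ i, ∀ a ∈ S i, 0 ≤ q i a

namespace ClusteringGame

variable {V : Type*} {G : SimpleGraph V} {c : ℕ}

/-- All edges are coordination edges. -/
def IsCoordination (Γ : ClusteringGame G c) : Prop := Γ.Ea = ∅

/-- The two endpoints of every edge have the same split parameter. -/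
def IsEqualSplit (Γ : ClusteringGame G c) : Prop := ∀ i j, G.Adj i j → Γ.α i j = Γ.α j i

/-- There are no individual preferences. -/
def NoPreferences (Γ : ClusteringGame G c) : Prop := ∀ i, ∀ a ∈ Γ.S i, Γ.q i a = 0

/-- `s` is a strategy profile: every player chooses one of her available colors. -/
def IsProfile (Γ : ClusteringGame G c) (s : V → Fin c) : Prop := ∀ i, s i ∈ Γ.S i

/-- The edge `{i, j}` is an edge of the graph that is satisfied in `s`. -/
def Satisfied (Γ : ClusteringGame G c) (s : V → Fin c) (i j : V) : Prop :=
  (s(i, j) ∈ Γ.Ec ∧ s i = s j) ∨ (s(i, j) ∈ Γ.Ea ∧ s i ≠ s j)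

open Classical in
/-- The utility `u_i(s)` of player `i`. -/
noncomputable def utility [Fintype V] (Γ : ClusteringGame G c) (s : V → Fin c) (i : V) : ℝ :=
  Γ.q i (s i) +
    ∑ j, if Γ.Satisfied s i j then Γ.α i j / (Γ.α i j + Γ.α j i) * Γ.w s(i, j) else 0

/-- The social welfare `u(s) = ∑ i, u_i(s)`. -/
noncomputable def welfare [Fintype V] (Γ : ClusteringGame G c) (s : V → Fin c) : ℝ :=
  ∑ i, Γ.utility s i

open Classical in
/-- The profile `(s_{-K}, s'_K)`: players in `K` follow `s'`, all others follow `s`. -/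
noncomputable def deviate (K : Finset V) (s s' : V → Fin c) : V → Fin c :=
  fun i => if i ∈ K then s' i else s i

/-- `s` is an `ε`-approximate `k`-strong equilibrium. -/
def IsEquilibrium [Fintype V] (Γ : ClusteringGame G c) (ε : ℝ) (k : ℕ) (s : V → Fin c) : Prop :=
  Γ.IsProfile s ∧
    ∀ K : Finset V, K.Nonempty → K.card ≤ k →
      ∀ s' : V → Fin c, (∀ i ∈ K, s' i ∈ Γ.S i) →
        ∃ j ∈ K, Γ.utility (deviate K s s') j ≤ ε * Γ.utility s j

/-- `t` is a strategy profile of maximum social welfare. -/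
def IsOptimal [Fintype V] (Γ : ClusteringGame G c) (t : V → Fin c) : Prop :=
  Γ.IsProfile t ∧ ∀ t', Γ.IsProfile t' → Γ.welfare t' ≤ Γ.welfare t

open Classical in
/-- The ratio `a / b` of two nonnegative welfare values, with `a / 0 = ∞` for `a > 0` and
`0 / 0 = 1`. -/
noncomputable def welfareRatio (a b : ℝ) : ENNReal :=
  if a = 0 ∧ b = 0 then 1 else ENNReal.ofReal a / ENNReal.ofReal b

/-- The `(ε, k)`-Price of Anarchy of a game: the worst ratio `u(s*) / u(s)` over all
`(ε, k)`-equilibria `s`, where `s*` is a social optimum (a game without `(ε, k)`-equilibria gets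
the value of the empty supremum). -/
noncomputable def poa [Fintype V] (Γ : ClusteringGame G c) (ε : ℝ) (k : ℕ) : ENNReal :=
  ⨆ (s : V → Fin c) (_ : Γ.IsEquilibrium ε k s) (t : V → Fin c) (_ : Γ.IsOptimal t),
    welfareRatio (Γ.welfare t) (Γ.welfare s)

/-- The `(ε, k)`-Price of Anarchy of a class of games. -/
noncomputable def classPoa [Fintype V] (𝒢 : Set (ClusteringGame G c)) (ε : ℝ) (k : ℕ) : ENNReal :=
  ⨆ Γ ∈ 𝒢, Γ.poa ε k

/-- All coordination games on `G` with `c` colors, arbitrary strategy sets, arbitrary weights,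
equal-split distribution rule and no individual preferences. -/
def equalSplitCoordinationGames {V : Type*} (G : SimpleGraph V) (c : ℕ) :
    Set (ClusteringGame G c) :=
  {Γ | Γ.IsCoordination ∧ Γ.IsEqualSplit ∧ Γ.NoPreferences}

end ClusteringGame

/-- The edge probability `d / n` (truncated to `1` for the finitely many `n < d`). -/
noncomputable def sparseProb (d : ℝ) (n : ℕ) : unitInterval :=
  Set.projIcc 0 1 zero_le_one (d / n)

/-! Up to constants depending only on `k`, the Price of Anarchy is `ε` times the maximum degree `Δ`
of the graph, and `Δ` is of order `ln n / ln ln n` in `G(n, d/n)`.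

Upper bound (`IsEquilibrium.welfare_le`): as `k ≥ 2`, the two ends of an edge that is monochromatic
in the optimum may deviate together, and each would earn at least `w/2` from it. In an equilibrium,
`w/2` is therefore at most `ε` times the current utility of one of them. Charging every edge to its
ends charges each vertex at most `Δ` times, so the ratio is at most `2εΔ`.

Lower bound (`le_classPoa_of_adj`): put weight on a star only, `1` on one edge and `ε/(k-1)` on the
others. The center stays with the edge of weight `1`, because a coalition brings at most `k-1` other
leaves, worth `ε` times its current utility. The optimum serves all the other leaves.

Degrees (`tendsto_binomialRandom_maxDegree`): a union bound over stars excludes large degrees. For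
the existence of a large degree, only edges between two halves of the vertex set are counted; the
degrees from one half into the other are independent, which avoids a second moment computation. -/

namespace ClusteringGame

variable {V : Type*} {G : SimpleGraph V} {c : ℕ}

/-! ### Upper bound by pair deviations -/

section

variable [Fintype V] {Γ : ClusteringGame G c}

-- Equal split parameters with positive sum make every share `1/2`. Membership of `s i` matters
-- because preferences vanish on available colors only.
open Classical in
theorem utility_eq_of_mem (hΓ : Γ ∈ equalSplitCoordinationGames G c) {s : V → Fin c} {i : V}
    (hi : s i ∈ Γ.S i) :
    Γ.utility s i = ∑ j, if G.Adj i j ∧ s i = s j then Γ.w s(i, j) / 2 else 0 := by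
  obtain ⟨hc, he, hp⟩ := hΓ
  have hEc : Γ.Ec = G.edgeSet := by
    have h := Γ.union_eq
    rw [show Γ.Ea = ∅ from hc, Set.union_empty] at h
    exact h
  have hEa : Γ.Ea = ∅ := hc
  rw [utility, hp i _ hi, zero_add]
  refine Finset.sum_congr rfl fun j _ => ?_
  have hsat : Γ.Satisfied s i j ↔ G.Adj i j ∧ s i = s j := by
    simp [Satisfied, hEc, hEa]
  simp only [hsat]
  split_ifs with h
  · have hα := Γ.α_pos i j h.1
    have heq := he i j h.1
    rw [← heq] at hα ⊢
    have : Γ.α i j ≠ 0 := by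
      intro h0
      simp [h0] at hα
    field_simp
    ring
  · rfl

theorem utility_nonneg (hΓ : Γ ∈ equalSplitCoordinationGames G c) {s : V → Fin c} {i : V}
    (hi : s i ∈ Γ.S i) : 0 ≤ Γ.utility s i := by
  classical
  rw [utility_eq_of_mem hΓ hi]
  refine Finset.sum_nonneg fun j _ => ?_
  split_ifs with h
  · exact div_nonneg (Γ.w_nonneg _ h.1) zero_le_two
  · exact le_rfl

theorem half_weight_le_utility (hΓ : Γ ∈ equalSplitCoordinationGames G c) {s : V → Fin c} {i j : V}
    (hi : s i ∈ Γ.S i) (hij : G.Adj i j) (hs : s i = s j) : Γ.w s(i, j) / 2 ≤ Γ.utility s i := by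
  classical
  rw [utility_eq_of_mem hΓ hi]
  have h := Finset.single_le_sum (s := Finset.univ)
    (f := fun j => if G.Adj i j ∧ s i = s j then Γ.w s(i, j) / 2 else 0) (fun j _ => by
      split_ifs with h
      · exact div_nonneg (Γ.w_nonneg _ h.1) zero_le_two
      · exact le_rfl) (Finset.mem_univ j)
  simpa only [hij, hs, and_self, if_true] using h

/-- The pair `{i, j}` deviates to `t`. Which of the two fails to gain is unknown, hence the sum of
both utilities on the right. -/
theorem IsEquilibrium.half_weight_le (hΓ : Γ ∈ equalSplitCoordinationGames G c) {ε : ℝ}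
    (hε : 1 ≤ ε) {k : ℕ} (hk : 2 ≤ k) {s t : V → Fin c} (hs : Γ.IsEquilibrium ε k s)
    (ht : Γ.IsProfile t) {i j : V} (hij : G.Adj i j) (hts : t i = t j) :
    Γ.w s(i, j) / 2 ≤ ε * (Γ.utility s i + Γ.utility s j) := by
  classical
  have hε0 : 0 ≤ ε := zero_le_one.trans hε
  have hui := mul_nonneg hε0 (utility_nonneg hΓ (hs.1 i))
  have huj := mul_nonneg hε0 (utility_nonneg hΓ (hs.1 j))
  obtain ⟨l, hl, hle⟩ := hs.2 {i, j} (by simp) (Finset.card_le_two.trans hk) t fun l _ => ht l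
  have hdi : deviate {i, j} s t i = t i := by simp [deviate]
  have hdj : deviate {i, j} s t j = t j := by simp [deviate]
  rw [mul_add]
  rcases Finset.mem_insert.1 hl with rfl | hl
  · have := half_weight_le_utility hΓ (s := deviate {l, j} s t) (by rw [hdi]; exact ht l) hij
      (by rw [hdi, hdj, hts])
    linarith
  · rw [Finset.mem_singleton.1 hl] at hle
    have := half_weight_le_utility hΓ (s := deviate {i, j} s t) (by rw [hdj]; exact ht j) hij.symm
      (by rw [hdi, hdj, hts])
    rw [Sym2.eq_swap] at this
    linarith

theorem IsEquilibrium.welfare_le (hΓ : Γ ∈ equalSplitCoordinationGames G c) {ε : ℝ}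
    (hε : 1 ≤ ε) {k : ℕ} (hk : 2 ≤ k) {D : ℕ}
    (hD : ∀ (v : V) (T : Finset V), (∀ j ∈ T, G.Adj v j) → T.card ≤ D)
    {s t : V → Fin c} (hs : Γ.IsEquilibrium ε k s) (ht : Γ.IsProfile t) :
    Γ.welfare t ≤ 2 * ε * D * Γ.welfare s := by
  classical
  have hε0 : 0 ≤ ε := zero_le_one.trans hε
  set u := Γ.utility s with hu
  have hu0 : ∀ i, 0 ≤ u i := fun i => utility_nonneg hΓ (hs.1 i)
  have hdeg : ∀ i, ∑ j, (if G.Adj i j then ε * u i else 0) ≤ D * (ε * u i) := fun i => by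
    rw [← Finset.sum_filter, Finset.sum_const, nsmul_eq_mul]
    refine mul_le_mul_of_nonneg_right ?_ (mul_nonneg hε0 (hu0 i))
    exact_mod_cast hD i _ (by simp)
  calc Γ.welfare t
      = ∑ i, ∑ j, if G.Adj i j ∧ t i = t j then Γ.w s(i, j) / 2 else 0 :=
        Finset.sum_congr rfl fun i _ => utility_eq_of_mem hΓ (ht i)
    _ ≤ ∑ i, ∑ j, ((if G.Adj i j then ε * u i else 0) + if G.Adj j i then ε * u j else 0) := by
        refine Finset.sum_le_sum fun i _ => Finset.sum_le_sum fun j _ => ?_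
        by_cases hij : G.Adj i j
        · by_cases htij : t i = t j
          · simp only [hij, hij.symm, htij, and_self, if_true]
            rw [← mul_add]
            exact hs.half_weight_le hΓ hε hk ht hij htij
          · simp only [hij, hij.symm, htij, and_false, if_true, if_false]
            exact add_nonneg (mul_nonneg hε0 (hu0 i)) (mul_nonneg hε0 (hu0 j))
        · simp [hij, G.adj_comm j i]
    -- The charges to the second endpoint become those to the first after swapping the sums.
    _ = 2 * ∑ i, ∑ j, (if G.Adj i j then ε * u i else 0) := by
        simp_rw [Finset.sum_add_distrib]
        rw [two_mul]
        congr 1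
        exact Finset.sum_comm
    _ ≤ 2 * ∑ i, D * (ε * u i) :=
        mul_le_mul_of_nonneg_left (Finset.sum_le_sum fun i _ => hdeg i) zero_le_two
    _ = 2 * ε * D * Γ.welfare s := by
        rw [welfare, ← Finset.mul_sum, ← Finset.mul_sum]
        ring

end

/-- `1 ≤ r` covers the convention `0 / 0 = 1`. -/
theorem welfareRatio_le {a b r : ℝ} (hr : 1 ≤ r) (h : a ≤ r * b) :
    welfareRatio a b ≤ ENNReal.ofReal r := by
  unfold welfareRatio
  split_ifs with h0
  · simpa using hr
  · refine ENNReal.div_le_of_le_mul ?_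
    rw [← ENNReal.ofReal_mul (zero_le_one.trans hr)]
    exact ENNReal.ofReal_le_ofReal h

theorem le_welfareRatio {a b r : ℝ} (hb : b ≤ 1) (h : r ≤ a) :
    ENNReal.ofReal r ≤ welfareRatio a b := by
  unfold welfareRatio
  split_ifs with h0
  · rw [ENNReal.ofReal_of_nonpos (h.trans_eq h0.1)]
    exact zero_le_one
  · refine (ENNReal.ofReal_le_ofReal h).trans ?_
    simpa using ENNReal.div_le_div_left
      (show ENNReal.ofReal b ≤ 1 by simpa using hb) (ENNReal.ofReal a)

/-- A graph whose vertices have at most `D` neighbors has Price of Anarchy at most `2εD`. -/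
theorem classPoa_le [Fintype V] {ε : ℝ} (hε : 1 ≤ ε) {k : ℕ} (hk : 2 ≤ k) {D : ℕ}
    (hD : ∀ (v : V) (T : Finset V), (∀ j ∈ T, G.Adj v j) → T.card ≤ D) {r : ℝ} (hr : 1 ≤ r)
    (hDr : 2 * ε * D ≤ r) :
    classPoa (equalSplitCoordinationGames G c) ε k ≤ ENNReal.ofReal r := by
  refine iSup₂_le fun Γ hΓ => iSup₂_le fun s hs => iSup₂_le fun t ht => ?_
  have h0 : 0 ≤ Γ.welfare s := Finset.sum_nonneg fun i _ => utility_nonneg hΓ (hs.1 i)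
  refine welfareRatio_le hr ?_
  exact (hs.welfare_le hΓ hε hk hD ht.1).trans (mul_le_mul_of_nonneg_right hDr h0)

/-- Without an optimum the inner supremum in `poa` would be empty and give no lower bound. -/
theorem exists_isOptimal [Fintype V] (Γ : ClusteringGame G c) : ∃ t, Γ.IsOptimal t := by
  classical
  obtain ⟨t, ht, hmax⟩ := Set.exists_max_image {t | Γ.IsProfile t} Γ.welfare (Set.toFinite _)
    ⟨fun i => (Γ.S_nonempty i).choose, fun i => (Γ.S_nonempty i).choose_spec⟩
  exact ⟨t, ht, hmax⟩

/-- The Price of Anarchy of a class is at least the welfare of any profile of a game in the class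
that has an equilibrium of welfare at most one. -/
theorem le_classPoa [Fintype V] {𝒢 : Set (ClusteringGame G c)} {Γ : ClusteringGame G c}
    (hΓ : Γ ∈ 𝒢) {ε : ℝ} {k : ℕ} {s t : V → Fin c} (hs : Γ.IsEquilibrium ε k s)
    (hs1 : Γ.welfare s ≤ 1) (ht : Γ.IsProfile t) {r : ℝ} (hr : r ≤ Γ.welfare t) :
    ENNReal.ofReal r ≤ classPoa 𝒢 ε k := by
  obtain ⟨t', ht'⟩ := Γ.exists_isOptimal
  refine (le_welfareRatio hs1 (hr.trans (ht'.2 t ht))).trans ?_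
  refine le_trans ?_ (le_iSup₂ (f := fun Γ (_ : Γ ∈ 𝒢) => Γ.poa ε k) Γ hΓ)
  refine le_trans ?_ (le_iSup₂ (f := fun s (_ : Γ.IsEquilibrium ε k s) =>
    ⨆ (t : V → Fin c) (_ : Γ.IsOptimal t), welfareRatio (Γ.welfare t) (Γ.welfare s)) s hs)
  exact le_iSup₂ (f := fun t (_ : Γ.IsOptimal t) => welfareRatio (Γ.welfare t) (Γ.welfare s)) t' ht'

end ClusteringGame

/-! ### Lower bound by star games -/

namespace ClusteringGame

variable {V : Type*} {c : ℕ}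

open Classical in
/-- The weights of a star with center `v`, whose edge to `j` has weight `ω j`. -/
noncomputable def starWeight (v : V) (ω : V → ℝ) : Sym2 V → ℝ :=
  Sym2.lift ⟨fun i j => if i = v then ω j else if j = v then ω i else 0, fun i j => by grind⟩

open Classical in
/-- The coordination game on a star with center `v`. The center chooses between the colors
`a 0` and `a 1`, the leaf `l` has to choose `a 0`, and all others choose between `a 1` and `a 2`. -/
noncomputable def starGame (G : SimpleGraph V) (v l : V) (ω : V → ℝ) (hω : ∀ j, 0 ≤ ω j)
    (a : Fin 3 → Fin c) : ClusteringGame G c where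
  Ec := G.edgeSet
  Ea := ∅
  union_eq := Set.union_empty _
  disjoint := Set.disjoint_empty _
  -- The center must choose between `l`, tied to `a 0`, and the others, which can never use `a 0`.
  -- The third color `a 2` lets the others stay away from `a 1`.
  S i := if i = v then {a 0, a 1} else if i = l then {a 0} else {a 1, a 2}
  S_nonempty i := by split_ifs <;> simp
  α _ _ := 1
  α_nonneg _ _ _ := zero_le_one
  α_pos _ _ _ := by norm_num
  w := starWeight v ω
  w_nonneg e _ := by
    induction e using Sym2.ind with
    | _ i j =>
      simp only [starWeight, Sym2.lift_mk]
      split_ifs <;> simp [hω]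
  q _ _ := 0
  q_nonneg _ _ _ := le_rfl

variable {G : SimpleGraph V} {v l : V} {ω : V → ℝ} {hω : ∀ j, 0 ≤ ω j}
  {a : Fin 3 → Fin c}

theorem starGame_mem : starGame G v l ω hω a ∈ equalSplitCoordinationGames G c :=
  ⟨rfl, fun _ _ _ => rfl, fun _ _ _ => rfl⟩

variable [Fintype V]

open Classical in
theorem starGame_utility_center {x : V → Fin c} (hx : x v ∈ (starGame G v l ω hω a).S v) :
    (starGame G v l ω hω a).utility x v =
      ∑ j, if G.Adj v j ∧ x v = x j then ω j / 2 else 0 := by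
  rw [utility_eq_of_mem starGame_mem hx]
  simp [starGame, starWeight]

-- This covers every vertex other than `v`, since pairs avoiding `v` have weight `0`.
open Classical in
theorem starGame_utility_leaf {x : V → Fin c} {i : V} (hi : i ≠ v)
    (hx : x i ∈ (starGame G v l ω hω a).S i) :
    (starGame G v l ω hω a).utility x i = if G.Adj v i ∧ x v = x i then ω i / 2 else 0 := by
  rw [utility_eq_of_mem starGame_mem hx, Finset.sum_eq_single v]
  · simp [starGame, starWeight, hi, G.adj_comm v i, eq_comm (a := x v)]
  · intro j _ hj
    simp [starGame, starWeight, hi, hj]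
  · simp

/-- The profile in which only the leaf `l` has the same color as the center. -/
theorem starGame_isEquilibrium (ha : Function.Injective a) {ε : ℝ} (hε : 1 ≤ ε) {k : ℕ}
    (hk : 2 ≤ k) (hlv : G.Adj v l) (hl : ω l = 1) (hle : ∀ j, j ≠ l → ω j ≤ ε / (k - 1))
    {s : V → Fin c} (hsv : s v = a 0) (hsl : s l = a 0) (hs : ∀ j, j ≠ v → j ≠ l → s j = a 2) :
    (starGame G v l ω hω a).IsEquilibrium ε k s := by
  classical
  have hlv' : l ≠ v := hlv.ne'
  have h01 : a 0 ≠ a 1 := ha.ne (by decide)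
  have h02 : a 0 ≠ a 2 := ha.ne (by decide)
  have h12 : a 1 ≠ a 2 := ha.ne (by decide)
  have hk0 : (0 : ℝ) < k - 1 := by
    have : (2 : ℝ) ≤ k := by exact_mod_cast hk
    linarith
  have hεk : 0 ≤ ε / (k - 1) := div_nonneg (zero_le_one.trans hε) hk0.le
  have hprof : (starGame G v l ω hω a).IsProfile s := by
    intro i
    by_cases hi : i = v
    · subst hi
      simp [starGame, hsv]
    · by_cases hil : i = l
      · subst hil
        simp [starGame, hi, hsl]
      · simp [starGame, hi, hil, hs i hi hil]
  refine ⟨hprof, fun K hK hKk s' hs' => ?_⟩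
  have hdS : ∀ i, deviate K s s' i ∈ (starGame G v l ω hω a).S i := fun i => by
    unfold deviate
    split_ifs with hi
    · exact hs' i hi
    · exact hprof i
  by_cases hvK : v ∈ K
  -- If the center takes part, it is the member that does not gain: its bound is `ε / 2`.
  · refine ⟨v, hvK, ?_⟩
    have hsv_half : 1 / 2 ≤ (starGame G v l ω hω a).utility s v := by
      have := half_weight_le_utility (starGame_mem (hω := hω) (l := l) (a := a)) (hprof v) hlv
        (hsv.trans hsl.symm)
      simpa [starGame, starWeight, hl] using this
    refine le_trans ?_ (mul_le_mul_of_nonneg_left hsv_half (zero_le_one.trans hε))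
    rw [starGame_utility_center (hdS v)]
    set x := deviate K s s' with hx
    have hxl : x l = a 0 := by simpa [starGame, hlv'] using hdS l
    have hxj : ∀ j, j ≠ v → j ≠ l → x j = a 1 ∨ x j = a 2 := fun j hj hjl => by
      simpa [starGame, hj, hjl] using hdS j
    have hxv : x v = a 0 ∨ x v = a 1 := by simpa [starGame] using hdS v
    rcases hxv with hxv | hxv
    · rw [Finset.sum_eq_single l]
      · split_ifs
        · rw [hl]; linarith
        · linarith
      · intro j _ hjl
        refine if_neg fun ⟨hj, h⟩ => ?_
        rcases hxj j hj.ne' hjl with h' | h' <;> rw [hxv, h'] at h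
        exacts [h01 h, h02 h]
      · simp
    -- On `a 1` the center meets coalition members only, as outsiders stay on `a 2`. There are at
    -- most `k - 1` of them, each worth `ε / (k - 1) / 2`.
    · have hterm : ∀ j, (if G.Adj v j ∧ x v = x j then ω j / 2 else 0) ≤
          if j ∈ K.erase v then ε / (k - 1) / 2 else 0 := fun j => by
        by_cases hj : G.Adj v j ∧ x v = x j
        · have hjv : j ≠ v := hj.1.ne'
          have hjl : j ≠ l := by
            rintro rfl
            exact h01 (hxl.symm.trans (hj.2.symm.trans hxv))
          have hjK : j ∈ K := by
            by_contra hjK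
            have hxj2 : x j = a 2 := by
              rw [hx, deviate, if_neg hjK, hs j hjv hjl]
            exact h12 (hxv.symm.trans (hj.2.trans hxj2))
          rw [if_pos hj, if_pos (Finset.mem_erase.2 ⟨hjv, hjK⟩)]
          linarith [hle j hjl]
        · rw [if_neg hj]
          split_ifs
          · exact div_nonneg hεk zero_le_two
          · exact le_rfl
      refine (Finset.sum_le_sum fun j _ => hterm j).trans ?_
      rw [Finset.sum_ite_mem, Finset.univ_inter, Finset.sum_const, nsmul_eq_mul]
      have hcard : ((K.erase v).card : ℝ) ≤ k - 1 := by
        rw [Finset.card_erase_of_mem hvK, Nat.cast_sub (Finset.card_pos.2 hK), Nat.cast_one]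
        exact sub_le_sub_right (by exact_mod_cast hKk) 1
      calc ((K.erase v).card : ℝ) * (ε / (k - 1) / 2) ≤ (k - 1) * (ε / (k - 1) / 2) :=
            mul_le_mul_of_nonneg_right hcard (div_nonneg hεk zero_le_two)
        _ = ε * (1 / 2) := by field_simp
  -- The center stays on `a 0`: `l` has no other color and nobody else can reach it, so no member
  -- gains.
  · obtain ⟨j, hj⟩ := hK
    have hjv : j ≠ v := fun h => hvK (h ▸ hj)
    refine ⟨j, hj, le_trans ?_ (le_mul_of_one_le_left (utility_nonneg starGame_mem (hprof j)) hε)⟩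
    have hdv : deviate K s s' v = a 0 := by simp [deviate, hvK, hsv]
    by_cases hjl : j = l
    · subst hjl
      have hdj : deviate K s s' j = a 0 := by simpa [starGame, hjv] using hdS j
      rw [starGame_utility_leaf hjv (hdS j), starGame_utility_leaf hjv (hprof j), hdv, hdj, hsv,
        hsl]
    · have hdj : deviate K s s' j = a 1 ∨ deviate K s s' j = a 2 := by
        simpa [starGame, hjv, hjl] using hdS j
      rw [starGame_utility_leaf hjv (hdS j), if_neg]
      · exact utility_nonneg starGame_mem (hprof j)
      · rintro ⟨-, h⟩
        rcases hdj with h' | h' <;> rw [hdv, h'] at h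
        exacts [h01 h, h02 h]

/-- A graph with a vertex that has all of `T` as neighbors has Price of Anarchy at least
`(|T| - 1)ε / (k - 1)`. -/
theorem le_classPoa_of_adj (hc : 3 ≤ c) {ε : ℝ} (hε : 1 ≤ ε) {k : ℕ} (hk : 2 ≤ k)
    {T : Finset V} (hT : ∀ j ∈ T, G.Adj v j) :
    ENNReal.ofReal ((T.card - 1 : ℝ) * (ε / (k - 1))) ≤
      classPoa (equalSplitCoordinationGames G c) ε k := by
  classical
  have hk0 : (0 : ℝ) < k - 1 := by
    have : (2 : ℝ) ≤ k := by exact_mod_cast hk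
    linarith
  have hεk : 0 ≤ ε / (k - 1) := div_nonneg (zero_le_one.trans hε) hk0.le
  rcases T.eq_empty_or_nonempty with rfl | ⟨l, hlT⟩
  · rw [ENNReal.ofReal_of_nonpos]
    · exact zero_le
    · simpa using hεk
  have hlv := (hT l hlT).ne'
  have ha := Fin.castLE_injective hc
  set a : Fin 3 → Fin c := Fin.castLE hc
  have h02 : a 0 ≠ a 2 := ha.ne (by decide)
  set ω : V → ℝ := fun j => if j = l then 1 else if j ∈ T then ε / (k - 1) else 0 with hω_def
  have hω : ∀ j, 0 ≤ ω j := fun j => by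
    simp only [hω_def]
    split_ifs <;> simp [hεk]
  set s : V → Fin c := fun j => if j = v ∨ j = l then a 0 else a 2 with hs_def
  set t : V → Fin c := fun j => if j = l then a 0 else a 1 with ht_def
  have ht : (starGame G v l ω hω a).IsProfile t := by
    intro i
    simp only [ht_def, starGame]
    split_ifs <;> simp_all
  have hs : (starGame G v l ω hω a).IsEquilibrium ε k s := by
    refine starGame_isEquilibrium ha hε hk (hT l hlT) (by simp [hω_def]) (fun j hj => ?_)
      (by simp [hs_def]) (by simp [hs_def]) (fun j hj hjl => by simp [hs_def, hj, hjl])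
    simp only [hω_def, hj, if_false]
    split_ifs
    · exact le_rfl
    · exact hεk
  refine le_classPoa starGame_mem hs ?_ ht ?_
  -- In `s` only `v` and `l` earn anything, at most `1/2` each.
  · have hu : ∀ i, (starGame G v l ω hω a).utility s i ≤
        if i ∈ ({v, l} : Finset V) then 1 / 2 else 0 := by
      intro i
      by_cases hi : i = v
      · subst hi
        rw [starGame_utility_center (hs.1 i), Finset.sum_eq_single l]
        · split_ifs <;> simp_all
        · intro j _ hjl
          refine if_neg fun ⟨hj, h⟩ => ?_
          simp only [hs_def, hj.ne', hjl, true_or, or_self, if_true, if_false] at h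
          exact h02 h
        · simp
      · rw [starGame_utility_leaf hi (hs.1 i)]
        by_cases hil : i = l
        · subst hil
          split_ifs <;> simp_all
        · rw [if_neg, if_neg]
          · simp [hi, hil]
          · rintro ⟨-, h⟩
            simp only [hs_def, hi, hil, true_or, or_self, if_true, if_false] at h
            exact h02 h
    refine (Finset.sum_le_sum fun i _ => hu i).trans ?_
    rw [Finset.sum_ite_mem, Finset.univ_inter, Finset.sum_const, Finset.card_pair hlv.symm]
    norm_num
  · have hu : ∀ i ∈ T.erase l, ε / (k - 1) / 2 ≤ (starGame G v l ω hω a).utility t i := by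
      intro i hi
      obtain ⟨hil, hiT⟩ := Finset.mem_erase.1 hi
      rw [starGame_utility_leaf (hT i hiT).ne' (ht i), if_pos]
      · simp [hω_def, hil, hiT]
      · exact ⟨hT i hiT, by simp [ht_def, hil, hlv.symm]⟩
    -- The center collects as much as the leaves in `T.erase l` are guaranteed together, which
    -- cancels the factor `1/2`.
    have hcenter : ∑ _i ∈ T.erase l, ε / (k - 1) / 2 ≤ (starGame G v l ω hω a).utility t v := by
      rw [starGame_utility_center (ht v)]
      refine le_trans (Finset.sum_le_sum fun i hi => ?_)
        (Finset.sum_le_sum_of_subset_of_nonneg (Finset.subset_univ (T.erase l)) fun i _ _ => ?_)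
      · obtain ⟨hil, hiT⟩ := Finset.mem_erase.1 hi
        rw [if_pos]
        · simp [hω_def, hil, hiT]
        · exact ⟨hT i hiT, by simp [ht_def, hil, hlv.symm]⟩
      · split_ifs
        · exact div_nonneg (hω i) zero_le_two
        · exact le_rfl
    have hsum : ∑ i ∈ insert v (T.erase l), (starGame G v l ω hω a).utility t i ≤
        (starGame G v l ω hω a).welfare t :=
      Finset.sum_le_sum_of_subset_of_nonneg (Finset.subset_univ _)
        fun i _ _ => utility_nonneg starGame_mem (ht i)
    rw [Finset.sum_insert fun h => (hT v (Finset.mem_of_mem_erase h)).ne rfl] at hsum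
    have hleaves := Finset.sum_le_sum hu
    have hcard : ((T.erase l).card : ℝ) = T.card - 1 := by
      rw [Finset.card_erase_of_mem hlT, Nat.cast_sub (Finset.card_pos.2 ⟨l, hlT⟩), Nat.cast_one]
    simp only [Finset.sum_const, nsmul_eq_mul, hcard] at hcenter hleaves
    linarith

end ClusteringGame

/-! ### Stars and degrees in the binomial random graph -/

namespace SimpleGraph

open MeasureTheory Measure ProbabilityTheory unitInterval

variable {V : Type*} {p : I}

/-- The Bernoulli distribution on `Prop`. -/
noncomputable abbrev bernoulliProp (p : I) : Measure Prop :=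
  toNNReal p • dirac True + toNNReal (σ p) • dirac False

instance (p : I) : IsProbabilityMeasure (bernoulliProp p) :=
  inferInstanceAs (IsProbabilityMeasure (toNNReal p • dirac True + toNNReal (σ p) • dirac False))

theorem measurable_mem_edgeSet {α : Type*} (f : α → Sym2 V) :
    Measurable fun (G : SimpleGraph V) a => f a ∈ G.edgeSet :=
  measurable_pi_iff.2 fun a => measurable_set_iff.1 measurable_edgeSet (f a)

variable [Finite V]

/-- The indicators of distinct potential edges are independent Bernoulli variables. -/
theorem binomialRandom_map_mem_edgeSet {α : Type*} {f : α → Sym2 V} (hf : Function.Injective f)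
    (hdiag : ∀ a, ¬ (f a).IsDiag) :
    (binomialRandom V p).map (fun G a => f a ∈ G.edgeSet) =
      infinitePi fun _ : α => bernoulliProp p := by
  have hset : Measurable fun q : Sym2 V → Prop => {i | q i} := by
    exact measurable_set_iff.2 fun i => measurable_pi_apply i
  rw [binomialRandom_eq_map, setBernoulli_eq_map, Measure.map_map measurable_fromEdgeSet hset,
    Measure.map_map (measurable_mem_edgeSet f) (measurable_fromEdgeSet.comp hset)]
  have hcomp : (fun (G : SimpleGraph V) a => f a ∈ G.edgeSet) ∘ (fromEdgeSet ∘ fun q => {i | q i}) =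
      fun (q : Sym2 V → Prop) a => q (f a) := by
    funext q a
    have := hdiag a
    simp_all
  rw [hcomp, map_infinitePi_infinitePi_of_inj hf]
  congr 1
  funext a
  have : (f a ∈ Sym2.diagSetᶜ) = True := by simpa using hdiag a
  rw [this]

/-- Independence of the edges from `v` to `T`. It is only an inequality because the event is empty
when `v ∈ T`. -/
theorem binomialRandom_forall_adj (v : V) (T : Finset V) :
    binomialRandom V p {G | ∀ j ∈ T, G.Adj v j} ≤ (toNNReal p : ENNReal) ^ T.card := by
  by_cases hv : v ∈ T
  · have : {G : SimpleGraph V | ∀ j ∈ T, G.Adj v j} = ∅ :=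
      Set.eq_empty_of_forall_notMem fun G hG => G.loopless.irrefl v (hG v hv)
    simp [this]
  · have hlaw := binomialRandom_map_mem_edgeSet (p := p) (f := fun j : T => s(v, (j : V)))
      (fun i j h => by
        rcases Sym2.eq_iff.1 h with h | h
        · exact Subtype.ext h.2
        · exact absurd (h.1 ▸ j.2) hv)
      (fun j h => hv (by rw [Sym2.mk_isDiag_iff] at h; exact h ▸ j.2))
    have hpre : {G : SimpleGraph V | ∀ j ∈ T, G.Adj v j} =
        (fun (G : SimpleGraph V) (j : T) => s(v, (j : V)) ∈ G.edgeSet) ⁻¹' {fun _ => True} := by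
      ext G
      simp [funext_iff]
    rw [hpre, ← map_apply (measurable_mem_edgeSet _) (Set.toFinite _).measurableSet, hlaw,
      infinitePi_singleton_of_fintype]
    simp

theorem binomialRandom_exists_forall_adj_le [Fintype V] (r : ℕ) :
    binomialRandom V p {G | ∃ (v : V) (T : Finset V), T.card = r ∧ ∀ j ∈ T, G.Adj v j} ≤
      Fintype.card V * ((Fintype.card V).choose r * (toNNReal p : ENNReal) ^ r) := by
  classical
  have hsub : {G : SimpleGraph V | ∃ (v : V) (T : Finset V), T.card = r ∧ ∀ j ∈ T, G.Adj v j} ⊆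
      ⋃ v ∈ (Finset.univ : Finset V), ⋃ T ∈ (Finset.univ : Finset V).powersetCard r,
        {G | ∀ j ∈ T, G.Adj v j} := by
    rintro G ⟨v, T, hT, h⟩
    simp only [Set.mem_iUnion]
    exact ⟨v, Finset.mem_univ v, T, by simp [hT], h⟩
  calc _ ≤ _ := measure_mono hsub
    _ ≤ _ := measure_biUnion_finset_le _ _
    _ ≤ ∑ v : V, ∑ T ∈ (Finset.univ : Finset V).powersetCard r, (toNNReal p : ENNReal) ^ r := by
        refine Finset.sum_le_sum fun v _ => (measure_biUnion_finset_le _ _).trans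
          (Finset.sum_le_sum fun T hT => ?_)
        rw [← (Finset.mem_powersetCard.1 hT).2]
        exact binomialRandom_forall_adj v T
    _ = _ := by simp

theorem infinitePi_bernoulliProp_ncard {β : Type*} [Finite β] (p : I) (r : ℕ) :
    (infinitePi fun _ : β => bernoulliProp p) {x | {b | x b}.ncard = r} =
      ENNReal.ofReal ((Nat.card β).choose r * p ^ r * (1 - p) ^ (Nat.card β - r)) := by
  have h := map_ncard_setBernoulli_singleton (Set.finite_univ (α := β)) p r
  rw [map_apply (by fun_prop) .of_discrete, setBernoulli_apply'] at h
  simp only [Set.mem_univ, Set.ncard_univ] at h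
  exact h

/-- Disjointness makes the pairs in `A × B` distinct potential edges, so the degrees into `B` are
independent over `A`. Each equals `r` with the binomial probability `q`, and `(1 - q) ^ |A| ≤ exp
(-|A| q)`. -/
theorem binomialRandom_forall_ncard_ne (A B : Finset V) (hAB : Disjoint A B) (r : ℕ) :
    binomialRandom V p {G | ∀ a ∈ A, {b : B | G.Adj a b}.ncard ≠ r} ≤
      ENNReal.ofReal (Real.exp
        (-(A.card * (B.card.choose r * p ^ r * (1 - p) ^ (B.card - r))))) := by
  have hdisj : ∀ (a : A) (b : B), (a : V) ≠ b := fun a b h =>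
    Finset.disjoint_left.1 hAB a.2 (h ▸ b.2)
  have hlaw := binomialRandom_map_mem_edgeSet (p := p)
    (f := fun x : A × B => s((x.1 : V), (x.2 : V)))
    (fun x y h => by
      rcases Sym2.eq_iff.1 h with h | h
      · exact Prod.ext (Subtype.ext h.1) (Subtype.ext h.2)
      · exact absurd h.1 (hdisj _ _))
    (fun x h => hdisj _ _ (by rwa [Sym2.mk_isDiag_iff] at h))
  set q : ℝ := B.card.choose r * p ^ r * (1 - p) ^ (B.card - r) with hq
  let E : Set (B → Prop) := {x | {b | x b}.ncard = r}
  have hEm : MeasurableSet E := (Set.toFinite _).measurableSet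
  have hE : (infinitePi fun _ : B => bernoulliProp p) E = ENNReal.ofReal q := by
    have := infinitePi_bernoulliProp_ncard (β := B) p r
    rwa [Nat.card_eq_fintype_card, Fintype.card_coe] at this
  have hq0 : 0 ≤ q :=
    mul_nonneg (mul_nonneg (Nat.cast_nonneg _) (pow_nonneg p.2.1 _))
      (pow_nonneg (sub_nonneg.2 p.2.2) _)
  have hq1 : q ≤ 1 := ENNReal.ofReal_le_one.1 (hE ▸ prob_le_one)
  -- Currying groups the edge indicators by their endpoint in `A`, turning the event into a product
  -- set.
  have hpre : {G : SimpleGraph V | ∀ a ∈ A, {b : B | G.Adj a b}.ncard ≠ r} =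
      (fun (G : SimpleGraph V) (x : A × B) => s((x.1 : V), (x.2 : V)) ∈ G.edgeSet) ⁻¹'
        (MeasurableEquiv.curry A B Prop ⁻¹' (Set.univ.pi fun _ => Eᶜ)) := by
    ext G
    simp [E]
  have hpi : MeasurableSet (Set.univ.pi fun _ : A => Eᶜ) := .univ_pi fun _ => hEm.compl
  rw [hpre, ← map_apply (measurable_mem_edgeSet _) (MeasurableEquiv.measurable _ hpi), hlaw,
    ← map_apply (MeasurableEquiv.measurable _) hpi,
    infinitePi_map_curry (fun (_ : A) (_ : B) => bernoulliProp p),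
    infinitePi_pi_univ _ fun _ => hEm.compl, tprod_fintype, Finset.prod_const, Finset.card_univ,
    Fintype.card_coe, measure_compl hEm (measure_ne_top _ _), measure_univ, hE,
    ← ENNReal.ofReal_one, ← ENNReal.ofReal_sub _ hq0, ← ENNReal.ofReal_pow (sub_nonneg.2 hq1)]
  refine ENNReal.ofReal_le_ofReal ?_
  rw [← mul_neg, Real.exp_nat_mul]
  exact pow_le_pow_left₀ (sub_nonneg.2 hq1) (Real.one_sub_le_exp_neg q) _

end SimpleGraph

/-! ### Asymptotic estimates -/

theorem tendsto_log_natCast_atTop : Tendsto (fun n : ℕ => Real.log n) atTop atTop :=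
  Real.tendsto_log_atTop.comp tendsto_natCast_atTop_atTop

theorem tendsto_log_log_natCast_atTop : Tendsto (fun n : ℕ => Real.log (Real.log n)) atTop atTop :=
  Real.tendsto_log_atTop.comp tendsto_log_natCast_atTop

theorem tendsto_log_div_log_log_atTop :
    Tendsto (fun n : ℕ => Real.log n / Real.log (Real.log n)) atTop atTop := by
  have h : Tendsto (fun x : ℝ => x / Real.log x) atTop atTop := by
    have h0 : Tendsto (fun x : ℝ => Real.log x / x) atTop (𝓝[>] 0) :=
      tendsto_nhdsWithin_iff.2 ⟨Real.isLittleO_log_id_atTop.tendsto_div_nhds_zero, by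
        filter_upwards [eventually_gt_atTop 1] with x hx
        exact div_pos (Real.log_pos hx) (zero_lt_one.trans hx)⟩
    simpa [Function.comp_def] using tendsto_inv_nhdsGT_zero.comp h0
  exact h.comp tendsto_log_natCast_atTop

theorem sparseProb_le {d : ℝ} (hd : 0 < d) (n : ℕ) : (sparseProb d n : ℝ) ≤ d / n := by
  rw [sparseProb, Set.coe_projIcc]
  exact max_le (div_nonneg hd.le n.cast_nonneg) (min_le_right _ _)

theorem sparseProb_eq {d : ℝ} (hd : 0 < d) {n : ℕ} (hn : d ≤ n) : (sparseProb d n : ℝ) = d / n := by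
  have hn0 : (0 : ℝ) < n := hd.trans_le hn
  rw [sparseProb, Set.coe_projIcc, min_eq_right ((div_le_one hn0).2 hn),
    max_eq_right (div_nonneg hd.le hn0.le)]

/-- The expected number of `r`-stars in `G(n, d / n)`, up to the factor `r!`, does not exceed
`n * d ^ r`. -/
theorem mul_choose_mul_sparseProb_pow_le {d : ℝ} (hd : 0 < d) {n : ℕ} (hn : 0 < n) (r : ℕ) :
    (n : ℝ) * (n.choose r * (sparseProb d n : ℝ) ^ r) ≤ n * (d ^ r / r.factorial) := by
  have hn0 : (0 : ℝ) < n := by exact_mod_cast hn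
  refine mul_le_mul_of_nonneg_left ?_ hn0.le
  calc (n.choose r : ℝ) * (sparseProb d n : ℝ) ^ r ≤ (n ^ r / r.factorial) * (d / n) ^ r :=
        mul_le_mul (Nat.choose_le_pow_div r n)
          (pow_le_pow_left₀ (sparseProb d n).2.1 (sparseProb_le hd n) r)
          (pow_nonneg (sparseProb d n).2.1 r) (by positivity)
    _ = d ^ r / r.factorial := by
        rw [div_pow]
        field_simp

/-- Used with `x = ln n`. One term of the exponential series gives `(d√x)^r / r! ≤ exp (d√x)`, while
the choice of `r` gives `√x ^ r ≥ exp (2x)`; dividing avoids Stirling. Any constant above `2` in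
place of `4` would still give decay. -/
theorem mul_pow_div_factorial_le {d x : ℝ} (hd : 0 < d) (hx : 1 < x) {r : ℕ}
    (hr : 4 * (x / Real.log x) ≤ r) :
    Real.exp x * (d ^ r / r.factorial) ≤ Real.exp (d * √x - x) := by
  have hx0 : 0 < x := zero_lt_one.trans hx
  have hlog : 0 < Real.log x := Real.log_pos hx
  have hs : 0 < √x := Real.sqrt_pos.2 hx0
  have hpow : Real.exp (2 * x) ≤ √x ^ r := by
    rw [← Real.exp_log (pow_pos hs r), Real.exp_le_exp, Real.log_pow, Real.log_sqrt hx0.le]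
    rw [← mul_div_assoc, div_le_iff₀ hlog] at hr
    linarith
  have hexp := Real.pow_div_factorial_le_exp (d * √x) (mul_pos hd hs).le r
  rw [mul_pow] at hexp
  have hfac : (0 : ℝ) < r.factorial := by exact_mod_cast r.factorial_pos
  have hle : d ^ r / r.factorial * Real.exp (2 * x) ≤ Real.exp (d * √x) := by
    refine le_trans ?_ hexp
    rw [div_mul_eq_mul_div]
    gcongr
  calc Real.exp x * (d ^ r / r.factorial)
      = Real.exp (-x) * (d ^ r / r.factorial * Real.exp (2 * x)) := by
        rw [show Real.exp x = Real.exp (-x) * Real.exp (2 * x) by rw [← Real.exp_add]; ring_nf]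
        ring
    _ ≤ Real.exp (-x) * Real.exp (d * √x) :=
        mul_le_mul_of_nonneg_left hle (Real.exp_pos _).le
    _ = Real.exp (d * √x - x) := by rw [← Real.exp_add]; ring_nf

theorem tendsto_exp_mul_sqrt_sub (d : ℝ) :
    Tendsto (fun x : ℝ => Real.exp (d * √x - x)) atTop (𝓝 0) := by
  refine Real.tendsto_exp_atBot.comp ?_
  have h1 : Tendsto (fun x : ℝ => √x * (√x - d)) atTop atTop :=
    Real.tendsto_sqrt_atTop.atTop_mul_atTop₀ (tendsto_atTop_add_const_right _ (-d)
      Real.tendsto_sqrt_atTop)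
  refine (tendsto_neg_atTop_atBot.comp h1).congr' ?_
  filter_upwards [eventually_ge_atTop 0] with x hx
  have := Real.mul_self_sqrt hx
  simp only [Function.comp_apply]
  linarith

/-- From `1 / (1 - y) ≤ 1 + 2y ≤ exp (2y)` for `0 ≤ y ≤ 1/2`. It keeps the probability of the absent
edges above a constant. -/
theorem exp_neg_le_one_sub_pow {d : ℝ} (hd : 0 < d) {n j : ℕ} (hn : 2 * d ≤ n) (hj : j ≤ n) :
    Real.exp (-(2 * d)) ≤ (1 - d / n) ^ j := by
  have hn0 : (0 : ℝ) < n := by linarith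
  have hx0 : 0 ≤ d / n := by positivity
  have hx : d / n ≤ 1 / 2 := by rw [div_le_iff₀ hn0]; linarith
  have h1 : Real.exp (-(2 * (d / n))) ≤ 1 - d / n := by
    have h2 : 0 < 1 - d / n := by linarith
    rw [Real.exp_neg, inv_le_comm₀ (Real.exp_pos _) h2]
    refine le_trans ?_ (Real.add_one_le_exp _)
    rw [inv_le_iff_one_le_mul₀ h2]
    nlinarith
  calc Real.exp (-(2 * d)) = Real.exp (-(2 * (d / n))) ^ n := by
        rw [← Real.exp_nat_mul]
        congr 1
        field_simp
    _ ≤ (1 - d / n) ^ n := pow_le_pow_left₀ (Real.exp_pos _).le h1 n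
    _ ≤ (1 - d / n) ^ j := pow_le_pow_of_le_one (by linarith) (by linarith) hj

/-- A lower bound on the expected number of vertices in one half of `G(n, d / n)` that have exactly
`r` neighbors in the other half. -/
theorem exp_le_mul_choose_mul {d : ℝ} (hd : 0 < d) {n r : ℕ} (hn : 2 * d ≤ n) (hn2 : 2 ≤ n)
    (hr : (r : ℝ) ≤ Real.log n / (2 * Real.log (Real.log n))) (hrn : 4 * r ≤ n)
    (hlog : 1 ≤ Real.log (Real.log n)) (hd' : 2 * |Real.log (d / 4)| ≤ Real.log (Real.log n)) :
    Real.exp (Real.log n / 4) * (Real.exp (-(2 * d)) / 4) ≤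
      (n / 2 : ℕ) * ((n - n / 2).choose r * (d / n) ^ r * (1 - d / n) ^ (n - n / 2 - r)) := by
  have hn0 : (0 : ℝ) < n := by linarith
  set L := Real.log n with hL
  have hL1 : 1 ≤ L := by
    by_contra! h
    have h0 : 0 ≤ L := Real.log_natCast_nonneg n
    linarith [Real.log_nonpos h0 h.le]
  have hL0 : 0 < L := by linarith
  set M := Real.log L with hM
  have hrM : r * M ≤ L / 2 := by
    rw [le_div_iff₀ (by linarith)] at hr
    linarith
  have hrL : (r : ℝ) ≤ L := by nlinarith [(Nat.cast_nonneg r : (0 : ℝ) ≤ r)]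
  -- Budget in powers of `n = exp L`: the factorial costs `n^(1/2)` and `(d/4)^r` at most `n^(1/4)`,
  -- so `n^(1/4)` remains from the factor `n`.
  have hfac : (r.factorial : ℝ) ≤ Real.exp (L / 2) := by
    calc (r.factorial : ℝ) ≤ (r : ℝ) ^ r := by exact_mod_cast r.factorial_le_pow
      _ ≤ L ^ r := pow_le_pow_left₀ r.cast_nonneg hrL r
      _ = Real.exp (r * M) := by rw [Real.exp_nat_mul, Real.exp_log hL0]
      _ ≤ Real.exp (L / 2) := Real.exp_le_exp.2 hrM
  have hdpow : Real.exp (-(L / 4)) ≤ (d / 4) ^ r := by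
    rw [← Real.exp_log (show 0 < d / 4 by positivity), ← Real.exp_nat_mul, Real.exp_le_exp]
    have h1 : -|Real.log (d / 4)| ≤ Real.log (d / 4) := neg_abs_le _
    have h2 := mul_le_mul_of_nonneg_left hd' (Nat.cast_nonneg (α := ℝ) r)
    have h3 := mul_le_mul_of_nonneg_left h1 (Nat.cast_nonneg (α := ℝ) r)
    linarith
  -- Each factor of the descending factorial is at least `n/4`, as `r ≤ n/4`.
  have hchoose : (d / 4) ^ r / r.factorial ≤ ((n - n / 2).choose r : ℝ) * (d / n) ^ r := by
    have h1 : ((n - n / 2 + 1 - r : ℕ) : ℝ) ^ r ≤ r.factorial * ((n - n / 2).choose r : ℝ) := by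
      have := Nat.pow_sub_le_descFactorial (n - n / 2) r
      rw [Nat.descFactorial_eq_factorial_mul_choose] at this
      exact_mod_cast this
    have h2 : (n : ℝ) / 4 ≤ ((n - n / 2 + 1 - r : ℕ) : ℝ) := by
      rw [div_le_iff₀ (by norm_num)]
      exact_mod_cast (by omega : n ≤ (n - n / 2 + 1 - r) * 4)
    rw [div_le_iff₀ (by positivity)]
    calc (d / 4) ^ r = (n / 4 : ℝ) ^ r * (d / n) ^ r := by
          rw [← mul_pow]
          congr 1
          field_simp
      _ ≤ (r.factorial * ((n - n / 2).choose r : ℝ)) * (d / n) ^ r :=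
          mul_le_mul_of_nonneg_right ((pow_le_pow_left₀ (by positivity) h2 r).trans h1)
            (by positivity)
      _ = _ := by ring
  have hlow : Real.exp (-(3 * L / 4)) ≤ ((n - n / 2).choose r : ℝ) * (d / n) ^ r := by
    refine le_trans ?_ hchoose
    rw [le_div_iff₀ (by positivity)]
    calc Real.exp (-(3 * L / 4)) * r.factorial
        ≤ Real.exp (-(3 * L / 4)) * Real.exp (L / 2) :=
          mul_le_mul_of_nonneg_left hfac (Real.exp_pos _).le
      _ = Real.exp (-(L / 4)) := by rw [← Real.exp_add]; ring_nf
      _ ≤ _ := hdpow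
  have hhalf : Real.exp L / 4 ≤ (n / 2 : ℕ) := by
    rw [hL, Real.exp_log hn0, div_le_iff₀ (by norm_num)]
    exact_mod_cast (by omega : n ≤ n / 2 * 4)
  have hj := exp_neg_le_one_sub_pow hd hn (show n - n / 2 - r ≤ n by omega)
  calc Real.exp (L / 4) * (Real.exp (-(2 * d)) / 4)
      = Real.exp L / 4 * (Real.exp (-(3 * L / 4)) * Real.exp (-(2 * d))) := by
        rw [show Real.exp (L / 4) = Real.exp L * Real.exp (-(3 * L / 4)) by
          rw [← Real.exp_add]; ring_nf]
        ring
    _ ≤ _ := by gcongr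

/-! ### Maximum degree and conclusion -/

/-- Subadditivity suffices, so the events need not be measurable. -/
theorem ENNReal.tendsto_measure_one_of_compl_le {Ω : ℕ → Type*} [∀ n, MeasurableSpace (Ω n)]
    {μ : ∀ n, MeasureTheory.Measure (Ω n)} [∀ n, MeasureTheory.IsProbabilityMeasure (μ n)]
    {E : ∀ n, Set (Ω n)} {f : ℕ → ENNReal} (hf : Tendsto f atTop (𝓝 0))
    (h : ∀ᶠ n in atTop, μ n (E n)ᶜ ≤ f n) : Tendsto (fun n => μ n (E n)) atTop (𝓝 1) := by
  have h1 : Tendsto (fun n => 1 - f n) atTop (𝓝 1) := by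
    simpa using ENNReal.Tendsto.sub tendsto_const_nhds hf (Or.inl ENNReal.one_ne_top)
  refine tendsto_of_tendsto_of_tendsto_of_le_of_le' h1 tendsto_const_nhds ?_
    (Eventually.of_forall fun n => MeasureTheory.prob_le_one)
  filter_upwards [h] with n hn
  rw [tsub_le_iff_right]
  calc 1 = μ n (E n ∪ (E n)ᶜ) := by simp
    _ ≤ μ n (E n) + μ n (E n)ᶜ := MeasureTheory.measure_union_le _ _
    _ ≤ _ := by gcongr

/-- With high probability, all degrees of `G(n, d / n)` are at most `⌈4 log n / log log n⌉`, and
some degree is at least `⌊log n / (2 log log n)⌋`. -/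
theorem SimpleGraph.tendsto_binomialRandom_maxDegree {d : ℝ} (hd : 0 < d) :
    Tendsto (fun n : ℕ => SimpleGraph.binomialRandom (Fin n) (sparseProb d n)
      {G | (∀ (v : Fin n) (T : Finset (Fin n)), (∀ j ∈ T, G.Adj v j) →
          T.card ≤ ⌈4 * (Real.log n / Real.log (Real.log n))⌉₊) ∧
        ∃ (v : Fin n) (T : Finset (Fin n)), (∀ j ∈ T, G.Adj v j) ∧
          T.card = ⌊Real.log n / (2 * Real.log (Real.log n))⌋₊}) atTop (𝓝 1) := by
  have hup : Tendsto (fun n : ℕ => Real.exp (d * √(Real.log n) - Real.log n)) atTop (𝓝 0) :=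
    (tendsto_exp_mul_sqrt_sub d).comp tendsto_log_natCast_atTop
  have hlow : Tendsto (fun n : ℕ => Real.exp
      (-(Real.exp (Real.log n / 4) * (Real.exp (-(2 * d)) / 4)))) atTop (𝓝 0) :=
    Real.tendsto_exp_neg_atTop_nhds_zero.comp
      ((Real.tendsto_exp_atTop.comp
        (tendsto_log_natCast_atTop.atTop_div_const (by norm_num))).atTop_mul_const (by positivity))
  refine ENNReal.tendsto_measure_one_of_compl_le
    (f := fun n => ENNReal.ofReal (Real.exp (d * √(Real.log n) - Real.log n)) + ENNReal.ofReal
      (Real.exp (-(Real.exp (Real.log n / 4) * (Real.exp (-(2 * d)) / 4))))) ?_ ?_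
  · simpa using (ENNReal.tendsto_ofReal hup).add (ENNReal.tendsto_ofReal hlow)
  filter_upwards [eventually_ge_atTop 2, tendsto_natCast_atTop_atTop.eventually_ge_atTop (2 * d),
    tendsto_log_log_natCast_atTop.eventually_ge_atTop 1,
    tendsto_log_log_natCast_atTop.eventually_ge_atTop (2 * |Real.log (d / 4)|),
    tendsto_log_natCast_atTop.eventually_gt_atTop 1,
    tendsto_natCast_atTop_atTop.eventually (Real.isLittleO_log_id_atTop.bound one_half_pos)]
    with n hn2 hnd hM hMd hL hLn
  have hn0 : (0 : ℝ) < n := by exact_mod_cast zero_lt_two.trans_le hn2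
  set p := sparseProb d n with hp
  set R := ⌈4 * (Real.log n / Real.log (Real.log n))⌉₊ with hR
  set r := ⌊Real.log n / (2 * Real.log (Real.log n))⌋₊ with hr
  have hr_le : (r : ℝ) ≤ Real.log n / (2 * Real.log (Real.log n)) :=
    Nat.floor_le (by positivity)
  have hrn : 4 * r ≤ n := by
    have h1 : Real.log n ≤ 1 / 2 * n := by
      simpa [abs_of_pos (zero_lt_one.trans hL)] using hLn
    have h2 : Real.log n / (2 * Real.log (Real.log n)) ≤ Real.log n / 2 := by
      gcongr
      linarith
    have h3 : (4 : ℝ) * r ≤ n := by linarith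
    exact_mod_cast h3
  obtain ⟨A, -, hA⟩ := Finset.exists_subset_card_eq (s := (Finset.univ : Finset (Fin n)))
    (n := n / 2) (by simpa using Nat.div_le_self n 2)
  have hAc : Aᶜ.card = n - n / 2 := by rw [Finset.card_compl, hA, Fintype.card_fin]
  -- A degree above `R` yields a star with exactly `R` leaves. If no degree-`r` witness exists, in
  -- particular no vertex of the half `A` has exactly `r` neighbors in `Aᶜ`.
  have hsub : {G : SimpleGraph (Fin n) | (∀ (v : Fin n) (T : Finset (Fin n)),
      (∀ j ∈ T, G.Adj v j) → T.card ≤ R) ∧ ∃ (v : Fin n) (T : Finset (Fin n)),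
        (∀ j ∈ T, G.Adj v j) ∧ T.card = r}ᶜ ⊆
      {G | ∃ (v : Fin n) (T : Finset (Fin n)), T.card = R ∧ ∀ j ∈ T, G.Adj v j} ∪
      {G | ∀ a ∈ A, {b : (Aᶜ : Finset (Fin n)) | G.Adj a b}.ncard ≠ r} := by
    intro G hG
    by_contra hcon
    simp only [Set.mem_union, Set.mem_ofPred_eq, not_or, not_forall, not_not] at hcon
    obtain ⟨h1, a, ha, h2⟩ := hcon
    refine hG ⟨fun v T hT => ?_, a, ?_⟩
    · by_contra! hlt
      obtain ⟨T', hT', hcard⟩ := Finset.exists_subset_card_eq hlt.le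
      exact h1 ⟨v, T', hcard, fun j hj => hT j (hT' hj)⟩
    · classical
      refine ⟨({b : (Aᶜ : Finset (Fin n)) | G.Adj a b}.toFinset).map ⟨_, Subtype.val_injective⟩,
        fun j hj => ?_, ?_⟩
      · obtain ⟨b, hb, rfl⟩ := Finset.mem_map.1 hj
        simpa using hb
      · rw [Finset.card_map, ← h2, Set.ncard_eq_toFinset_card']
  refine (MeasureTheory.measure_mono hsub).trans ((MeasureTheory.measure_union_le _ _).trans
    (add_le_add ?_ ?_))
  · refine (binomialRandom_exists_forall_adj_le R).trans ?_
    have hpe : (unitInterval.toNNReal p : ENNReal) = ENNReal.ofReal p := by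
      rw [ENNReal.ofReal, Real.toNNReal_of_nonneg p.2.1]
      rfl
    rw [Fintype.card_fin, hpe, ← ENNReal.ofReal_pow p.2.1, ← ENNReal.ofReal_natCast,
      ← ENNReal.ofReal_natCast, ← ENNReal.ofReal_mul (by positivity),
      ← ENNReal.ofReal_mul (by positivity)]
    refine ENNReal.ofReal_le_ofReal
      ((mul_choose_mul_sparseProb_pow_le hd (zero_lt_two.trans_le hn2) R).trans ?_)
    have := mul_pow_div_factorial_le hd hL (Nat.le_ceil _)
    rwa [Real.exp_log hn0] at this
  · refine (binomialRandom_forall_ncard_ne A Aᶜ disjoint_compl_right r).trans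
      (ENNReal.ofReal_le_ofReal (Real.exp_le_exp.2 (neg_le_neg ?_)))
    rw [hA, hAc, hp, sparseProb_eq hd (by linarith)]
    exact exp_le_mul_choose_mul hd hnd hn2 hr_le hrn hM hMd

theorem theorem12 (k : ℕ) (hk : 2 ≤ k) (d : ℝ) (hd : 0 < d) :
    ∃ C₁ C₂ : ℝ, 0 < C₁ ∧ 0 < C₂ ∧
      ∀ ε : ℝ, 1 ≤ ε → ∀ c : ℕ → ℕ, (∀ n, 3 ≤ c n) →
        Tendsto
          (fun n : ℕ => SimpleGraph.binomialRandom (Fin n) (sparseProb d n)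
            {G : SimpleGraph (Fin n) |
              ENNReal.ofReal (C₁ * (ε * Real.log n / Real.log (Real.log n))) ≤
                ClusteringGame.classPoa
                  (ClusteringGame.equalSplitCoordinationGames G (c n)) ε k ∧
              ClusteringGame.classPoa
                  (ClusteringGame.equalSplitCoordinationGames G (c n)) ε k ≤
                ENNReal.ofReal (C₂ * (ε * Real.log n / Real.log (Real.log n)))})
          atTop (𝓝 1) := by
  have hk0 : (0 : ℝ) < k - 1 := by
    have : (2 : ℝ) ≤ k := by exact_mod_cast hk
    linarith
  -- With `x = ln n / ln ln n ≥ 8`: `⌊x/2⌋ - 1 ≥ x/2 - 2 ≥ x/4`, and `2ε⌈4x⌉ ≤ 2ε(4x + 1) ≤ 10εx`.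
  -- The threshold `8` depends on neither `ε` nor `c`.
  refine ⟨1 / (4 * (k - 1)), 10, by positivity, by norm_num, fun ε hε c hc => ?_⟩
  refine tendsto_of_tendsto_of_tendsto_of_le_of_le'
    (SimpleGraph.tendsto_binomialRandom_maxDegree hd) tendsto_const_nhds ?_
    (Eventually.of_forall fun n => MeasureTheory.prob_le_one)
  filter_upwards [tendsto_log_div_log_log_atTop.eventually_ge_atTop 8] with n hn
  refine MeasureTheory.measure_mono ?_
  rintro G ⟨hup, v, T, hT, hcard⟩
  have hε0 : 0 < ε := zero_lt_one.trans_le hε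
  rw [mul_div_assoc]
  set x := Real.log n / Real.log (Real.log n) with hx
  constructor
  · refine le_trans (ENNReal.ofReal_le_ofReal ?_)
      (ClusteringGame.le_classPoa_of_adj (hc n) hε hk hT)
    have hfloor : x / 2 < T.card + 1 := by
      rw [hcard, hx, div_div, mul_comm (Real.log (Real.log n))]
      exact Nat.lt_floor_add_one _
    have : 1 / (4 * (k - 1 : ℝ)) * (ε * x) = x / 4 * (ε / (k - 1)) := by field_simp
    rw [this]
    exact mul_le_mul_of_nonneg_right (by linarith) (by positivity)
  · refine ClusteringGame.classPoa_le hε hk hup ?_ ?_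
    · nlinarith
    · have hceil := Nat.ceil_lt_add_one (show 0 ≤ 4 * x by linarith)
      nlinarith
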